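/- **Setting.** Let $D\ge 0$ be an integer and equip $\mathbb Z^D$ with the norm $|x|=\sum_i|x_i|$ and the distance $d(x,y)=|x-y|$. Let $N_x\ge 1$ ($x\in\mathbb Z^D$) be uniformly bounded integers. For finite $\Lambda\subset\mathbb Z^D$ put $\mathfrak U_\Lambda=\bigotimes_{x\in\Lambda}M_{N_x}(\mathbb C)$, let $\mathfrak U_{\rm loc}=\bigcup_\Lambda\mathfrak U_\Lambda$ (for the inclusions $A\mapsto A\otimes\mathbb 1$), and let $\mathfrak U$ be the C$^*$-algebra obtained as the norm completion of $\mathfrak U_{\rm loc}$. A *quantum lattice dynamical system* is a triple $(\mathfrak U,\iota,\tau)$ where $\iota$ is a representation of $\mathbb Z^D$ by $^*$-automorphisms of $\mathfrak U$ with $\iota_x(\mathfrak U_\Lambda)\subset\mathfrak U_{\Lambda+x}$, and $\tau$ is a strongly continuous representation of $\mathbb R$ by $^*$-automorphisms of $\mathfrak U$ with $\tau_t\iota_x=\iota_x\tau_t$ for all $t,x$. An *interaction* assigns to every finite $\Lambda\subset\mathbb Z^D$ a self-adjoint $\Phi(\Lambda)\in\mathfrak U_\Lambda$; it *defines* $\tau$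 if, with $H_\Lambda=\sum_{X\subset\Lambda}\Phi(X)$, one has $\tau_t(A)=\lim_{\Lambda\to\mathbb Z^D}e^{itH_\Lambda}Ae^{-itH_\Lambda}$ in norm for all $A\in\mathfrak U_{\rm loc}$, $t\in\mathbb R$ (limit along the net of finite sets). Call $\tau$ *short-range* if it is defined by an interaction $\Phi$ such that, for some $\lambda>0$ and some $F:[0,\infty)\to(0,\infty)$ with $\sup_x\sum_yF(d(x,y))<\infty$ and $\sup_{x,y}\sum_z F(d(x,z))F(d(z,y))/F(d(x,y))<\infty$, $$\sup_{x,y\in\mathbb Z^D}\ \sum_{X\ni x,y}\frac{\|\Phi(X)\|}{e^{-\lambda d(x,y)}F(d(x,y))}<\infty .$$ A *state* is a positive linear functional of norm $1$ on $\mathfrak U$. A state $\omega$ is *space-like clustering* for $(\mathfrak U,\iota,\tau)$ if there is $\upsilon_c>0$ such that for all $x\in\mathbb Z^D\setminus\{0\}$, all $\upsilon\in\mathbb R$ with $|\upsilon|>\upsilon_c$ and all $A,B\in\mathfrak U$, $$\lim_{r\to\infty,\ r\in\mathbb N}\omega\big(\iota_{rx}\tau_{r\upsilon^{-1}|x|}(A)\,B\big)=\omega(A)\,\omega(B).$$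 For $\beta\in\mathbb R$, a state $\omega$ is a *$(\tau',\beta)$-KMS state* if there is a norm-dense, $\tau'$-invariant $^*$-subalgebra of $\mathfrak U$ consisting of entire analytic elements for $\tau'$ such that $\omega(A\,\tau'_{i\beta}(B))=\omega(BA)$ for all $A,B$ in it, where $z\mapsto\tau'_z(B)$ is the entire continuation of $t\mapsto\tau'_t(B)$. Let $\mathbb S^{D-1}_{\mathbb Q}=\{x/|x|:x\in\mathbb Z^D\setminus\{0\}\}$ be the set of rational directions, and write $\lfloor a\rfloor=(\lfloor a_1\rfloor,\dots,\lfloor a_D\rfloor)$ for $a\in\mathbb R^D$. **Theorem.** Let $(\mathfrak U,\iota,\tau)$ and $(\mathfrak U,\iota,\tau')$ be quantum lattice dynamical systems with the same $\iota$, such that $\tau$ and $\tau'$ are both short-range and $\tau_s\tau'_t=\tau'_t\tau_s$ for all $s,t\in\mathbb R$. Let $\beta\in\mathbb R$ and let $\omega_\beta$ be a $(\tau',\beta)$-KMS state that is space-like clustering for $(\mathfrak U,\iota,\tau)$, with GNS representation $(H,\pi,\Omega)$. Then for every $A\in\mathfrak U$, every rational direction $q\in\mathbb S^{D-1}_{\mathbb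 Q}$ and Lebesgue-almost every speed $\upsilon\in\mathbb R$, the function $t\mapsto\pi(\iota_{\lfloor\upsilon qt\rfloor}\tau_tA)$ with values in $B(H)$ is Bochner integrable on bounded intervals, and $$\lim_{T\to\infty}\Big(\frac1T\int_0^T\pi\big(\iota_{\lfloor\upsilon qt\rfloor}\tau_tA\big)\,dt\Big)\Psi=\omega_\beta(A)\,\Psi\qquad\text{in the norm of }H,\text{ for all }\Psi\in H.$$ That is, the ray averages of $A$ converge to $\omega_\beta(A)\mathbb 1$ in the strong operator topology, along almost every ray of every rational direction. -/

import Mathlib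

open scoped ENNReal

namespace QSL

noncomputable section

/-! ### The lattice -/

/-- The lattice `ℤ^D`. -/
abbrev Lattice (D : ℕ) : Type := Fin D → ℤ

/-- The `ℓ¹` norm on `ℤ^D`. -/
def normOne {D : ℕ} (x : Lattice D) : ℝ := ∑ i, |(x i : ℝ)|

/-- The distance of two lattice points. -/
def latticeDist {D : ℕ} (x y : Lattice D) : ℝ := normOne (x - y)

/-- The translate `Λ + x` of a finite set of sites. -/
def translate {D : ℕ} (x : Lattice D) (Λ : Finset (Lattice D)) : Finset (Lattice D) :=
  Λ.map (addRightEmbedding x)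

/-- The rational directions `x / |x|`, with `x` a nonzero lattice vector. -/
def rationalSphere (D : ℕ) : Set (Fin D → ℝ) :=
  {q | ∃ x : Lattice D, x ≠ 0 ∧ q = fun i => (x i : ℝ) / normOne x}

/-- The componentwise integer part of a vector. -/
def floorVec {D : ℕ} (a : Fin D → ℝ) : Lattice D := fun i => ⌊a i⌋

/-! ### The quasi-local algebra

The local algebra of a finite `Λ` is `⨂_{x ∈ Λ} M_{N x}(ℂ)`, and the quasi-local algebra is the norm
completion of the increasing union of the local algebras. All of these algebras are realised by
bounded operators on the Hilbert space `ℓ²` over the set of all configurations: a matrix at the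
site `x` acts on the variable at `x` alone. In this way `⨂_{x ∈ Λ} M_{N x}(ℂ)` acts faithfully
(hence isometrically) as `A ⊗ 1`, compatibly with the inclusions, and the completion of the union
is its norm closure. -/

/-- Configurations: a choice, at each site `x`, of one of `N x` basis states. -/
abbrev Config {D : ℕ} (N : Lattice D → ℕ) : Type := ∀ x, Fin (N x)

/-- The Hilbert space of square-summable functions of the configuration. -/
abbrev ConfigSpace {D : ℕ} (N : Lattice D → ℕ) : Type := lp (fun _ : Config N => ℂ) 2

section SiteOperators

variable {D : ℕ} {N : Lattice D → ℕ}

/-- The permutation of the configurations which exchanges the basis states `i`, `j` at `x`. -/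
def swapAt (x : Lattice D) (i j : Fin (N x)) : Equiv.Perm (Config N) where
  toFun σ := Function.update σ x (Equiv.swap i j (σ x))
  invFun σ := Function.update σ x (Equiv.swap i j (σ x))
  left_inv σ := by simp
  right_inv σ := by simp

lemma unit_norm_le (x : Lattice D) (i j : Fin (N x)) (ξ : Config N → ℂ) (σ : Config N) :
    ‖(if σ x = i then ξ (Function.update σ x j) else 0 : ℂ)‖ ≤ ‖ξ (swapAt x i j σ)‖ := by
  split_ifs with h
  · subst h
    simp [swapAt]
  · simp

lemma unit_memℓp (x : Lattice D) (i j : Fin (N x)) (ξ : ConfigSpace N) :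
    Memℓp (fun σ : Config N => if σ x = i then ξ (Function.update σ x j) else 0) 2 := by
  have h := (lp.memℓp ξ).summable (by norm_num)
  refine memℓp_gen (Summable.of_nonneg_of_le (fun σ => by positivity) (fun σ => ?_)
    ((swapAt x i j).summable_iff.mpr h))
  exact Real.rpow_le_rpow (norm_nonneg _) (unit_norm_le x i j ξ σ) (by norm_num)

lemma unit_norm_bound (x : Lattice D) (i j : Fin (N x)) (ξ : ConfigSpace N) :
    ‖(⟨fun σ => if σ x = i then ξ (Function.update σ x j) else 0, unit_memℓp x i j ξ⟩ :
      ConfigSpace N)‖ ≤ ‖ξ‖ := by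
  have h := (lp.memℓp ξ).summable (by norm_num)
  refine lp.norm_le_of_tsum_le (by norm_num) (norm_nonneg _) ?_
  rw [lp.norm_rpow_eq_tsum (by norm_num),
    ← (swapAt x i j).tsum_eq (fun σ => ‖ξ σ‖ ^ (2 : ℝ≥0∞).toReal)]
  refine Summable.tsum_le_tsum (fun σ => ?_) ((unit_memℓp x i j ξ).summable (by norm_num))
    ((swapAt x i j).summable_iff.mpr h)
  exact Real.rpow_le_rpow (norm_nonneg _) (unit_norm_le x i j ξ σ) (by norm_num)

/-- The matrix unit `|i⟩⟨j|` at the site `x`. -/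
def siteUnit (x : Lattice D) (i j : Fin (N x)) : ConfigSpace N →L[ℂ] ConfigSpace N :=
  LinearMap.mkContinuous
    { toFun := fun ξ => ⟨fun σ => if σ x = i then ξ (Function.update σ x j) else 0,
        unit_memℓp x i j ξ⟩
      map_add' := fun ξ η => by
        ext σ
        simp only [lp.coeFn_add, Pi.add_apply]
        split_ifs <;> simp
      map_smul' := fun c ξ => by
        ext σ
        simp only [lp.coeFn_smul, Pi.smul_apply, RingHom.id_apply]
        split_ifs <;> simp }
    1 (fun ξ => by simpa using unit_norm_bound x i j ξ)

lemma siteUnit_apply (x : Lattice D) (i j : Fin (N x)) (ξ : ConfigSpace N) (σ : Config N) :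
    siteUnit x i j ξ σ = if σ x = i then ξ (Function.update σ x j) else 0 := rfl

lemma star_siteUnit (x : Lattice D) (i j : Fin (N x)) :
    star (siteUnit x i j : ConfigSpace N →L[ℂ] ConfigSpace N) = siteUnit x j i := by
  rw [ContinuousLinearMap.star_eq_adjoint]
  symm
  rw [ContinuousLinearMap.eq_adjoint_iff]
  intro ξ η
  rw [lp.inner_eq_tsum, lp.inner_eq_tsum, ← (swapAt x i j).tsum_eq]
  congr 1
  ext σ
  simp only [siteUnit_apply]
  by_cases h : σ x = i
  · subst h
    simp [swapAt]
  · have h' : ¬ (swapAt x i j σ) x = j := by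
      intro hj
      apply h
      have : Equiv.swap i j (σ x) = j := by simpa [swapAt] using hj
      exact (Equiv.swap i j).injective (this.trans (Equiv.swap_apply_left i j).symm)
    simp [h, h']

/-- The operator of a matrix `M` at the site `x`,
`(M ξ)(σ) = ∑ j, M (σ x) j * ξ (σ with the value j at x)`. -/
def siteOp (x : Lattice D) (M : Matrix (Fin (N x)) (Fin (N x)) ℂ) :
    ConfigSpace N →L[ℂ] ConfigSpace N :=
  ∑ i, ∑ j, M i j • siteUnit x i j

lemma siteOp_apply (x : Lattice D) (M : Matrix (Fin (N x)) (Fin (N x)) ℂ) (ξ : ConfigSpace N)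
    (σ : Config N) : siteOp x M ξ σ = ∑ j, M (σ x) j * ξ (Function.update σ x j) := by
  simp only [siteOp, sum_apply, lp.coeFn_sum, Finset.sum_apply,
    smul_apply, lp.coeFn_smul, Pi.smul_apply, siteUnit_apply, smul_eq_mul]
  rw [Finset.sum_eq_single (σ x)]
  · simp
  · intro i _ hi
    simp [hi.symm]
  · simp

/-- The representation of the matrix algebra `M_{N x}(ℂ)` at the site `x`. -/
def siteRep (N : Lattice D → ℕ) (x : Lattice D) :
    Matrix (Fin (N x)) (Fin (N x)) ℂ →⋆ₐ[ℂ] (ConfigSpace N →L[ℂ] ConfigSpace N) where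
  toFun := siteOp x
  map_one' := by
    ext ξ σ
    simp [siteOp_apply, Matrix.one_apply]
  map_mul' A B := by
    ext ξ σ
    simp only [siteOp_apply, mul_apply_eq_comp, Matrix.mul_apply, Finset.sum_mul,
      Finset.mul_sum, Function.update_self, Function.update_idem]
    rw [Finset.sum_comm]
    simp [mul_assoc]
  map_zero' := by simp [siteOp]
  map_add' A B := by simp [siteOp, add_smul, Finset.sum_add_distrib]
  commutes' c := by
    ext ξ σ
    simp [siteOp_apply, Matrix.one_apply, Algebra.algebraMap_eq_smul_one]
  map_star' A := by
    simp only [siteOp, star_sum, star_smul, star_siteUnit, Matrix.star_apply]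
    rw [Finset.sum_comm]

end SiteOperators

/-- The local algebra of a finite `Λ`, generated by the one-site algebras of the sites in `Λ`, as
an algebra of operators. -/
def localOps {D : ℕ} (N : Lattice D → ℕ) (Λ : Finset (Lattice D)) :
    StarSubalgebra ℂ (ConfigSpace N →L[ℂ] ConfigSpace N) :=
  ⨆ x ∈ Λ, (siteRep N x).range

/-- The norm closure of the union of the (increasing) net of local algebras. -/
def quasiLocalOps {D : ℕ} (N : Lattice D → ℕ) :
    StarSubalgebra ℂ (ConfigSpace N →L[ℂ] ConfigSpace N) :=
  (⨆ Λ : Finset (Lattice D), localOps N Λ).topologicalClosure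

instance {D : ℕ} (N : Lattice D → ℕ) :
    IsClosed (quasiLocalOps N : Set (ConfigSpace N →L[ℂ] ConfigSpace N)) :=
  StarSubalgebra.isClosed_topologicalClosure _

/-- The quasi-local C⋆-algebra of the quantum spin lattice with an `N x`-dimensional spin at `x`. -/
abbrev Quasilocal {D : ℕ} (N : Lattice D → ℕ) : Type := quasiLocalOps N

/-- The local algebra of `Λ`, as a subalgebra of the quasi-local algebra. -/
def localAlgebra {D : ℕ} (N : Lattice D → ℕ) (Λ : Finset (Lattice D)) :
    StarSubalgebra ℂ (Quasilocal N) :=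
  (localOps N Λ).comap (quasiLocalOps N).subtype

/-! ### Dynamics -/

section Dynamics

variable {D : ℕ} {N : Lattice D → ℕ}

/-- `(𝔘, ι, τ)` is a quantum lattice C⋆-dynamical system: `ι` and `τ` are representations of `ℤ^D`
and of `ℝ` by ⋆-automorphisms, `ι` translates the local algebras, `τ` is strongly continuous and
commutes with `ι`. -/
structure IsLatticeSystem (ι : Lattice D → (Quasilocal N ≃⋆ₐ[ℂ] Quasilocal N))
    (τ : ℝ → (Quasilocal N ≃⋆ₐ[ℂ] Quasilocal N)) : Prop where
  space_zero : ∀ A, ι 0 A = A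
  space_add : ∀ x y A, ι (x + y) A = ι x (ι y A)
  space_local : ∀ Λ x A, A ∈ localAlgebra N Λ → ι x A ∈ localAlgebra N (translate x Λ)
  time_zero : ∀ A, τ 0 A = A
  time_add : ∀ s t A, τ (s + t) A = τ s (τ t A)
  time_continuous : ∀ A, Continuous fun t => τ t A
  homogeneous : ∀ t x A, τ t (ι x A) = ι x (τ t A)

/-- An interaction: a hermitian element of the local algebra of `Λ`, for each finite `Λ`. -/
structure IsInteraction (Φ : Finset (Lattice D) → Quasilocal N) : Prop where
  mem_local : ∀ Λ, Φ Λ ∈ localAlgebra N Λ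
  hermitian : ∀ Λ, star (Φ Λ) = Φ Λ

/-- The Hamiltonian `H_Λ = ∑_{X ⊆ Λ} Φ(X)`. -/
def hamiltonian (Φ : Finset (Lattice D) → Quasilocal N) (Λ : Finset (Lattice D)) :
    Quasilocal N :=
  ∑ X ∈ Λ.powerset, Φ X

/-- The local time evolution `exp(i t H_Λ) A exp(-i t H_Λ)`. -/
def localEvolution (Φ : Finset (Lattice D) → Quasilocal N) (Λ : Finset (Lattice D)) (t : ℝ)
    (A : Quasilocal N) : Quasilocal N :=
  NormedSpace.exp ((Complex.I * t) • hamiltonian Φ Λ) * A *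
    NormedSpace.exp (-(Complex.I * t) • hamiltonian Φ Λ)

/-- The time evolution `τ` is defined by the interaction `Φ`: on local observables it is the norm
limit of the local time evolutions as `Λ → ℤ^D`. -/
def IsDefinedBy (τ : ℝ → (Quasilocal N ≃⋆ₐ[ℂ] Quasilocal N))
    (Φ : Finset (Lattice D) → Quasilocal N) : Prop :=
  ∀ (t : ℝ) (Λ₀ : Finset (Lattice D)), ∀ A ∈ localAlgebra N Λ₀,
    Filter.Tendsto (fun Λ => localEvolution Φ Λ t A) Filter.atTop (nhds (τ t A))

/-- Conditions on a decay function `F : [0, ∞) → (0, ∞)`: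
`sup_x ∑_y F(d(x,y)) < ∞` and `sup_{x,y} ∑_z F(d(x,z)) F(d(z,y)) / F(d(x,y)) < ∞`. -/
structure IsDecayFunction (D : ℕ) (F : ℝ → ℝ) : Prop where
  pos : ∀ r, 0 ≤ r → 0 < F r
  summable : ⨆ x : Lattice D, ∑' y : Lattice D, ENNReal.ofReal (F (latticeDist x y)) < ∞
  convolution : ⨆ (x : Lattice D) (y : Lattice D), ∑' z : Lattice D,
    ENNReal.ofReal (F (latticeDist x z) * F (latticeDist z y) / F (latticeDist x y)) < ∞

/-- The norm `‖Φ‖_λ = sup_{x,y} ∑_{X ∋ x,y} ‖Φ(X)‖ / F_λ(d(x,y))`, where `F_λ(r) = e^{-λr} F(r)`. -/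
def interactionNorm (Φ : Finset (Lattice D) → Quasilocal N) (F : ℝ → ℝ) (lam : ℝ) : ℝ≥0∞ :=
  ⨆ (x : Lattice D) (y : Lattice D), ∑' X : {X : Finset (Lattice D) // x ∈ X ∧ y ∈ X},
    ENNReal.ofReal (‖Φ X.1‖ / (Real.exp (-lam * latticeDist x y) * F (latticeDist x y)))

/-- The time evolution `τ` is defined by an interaction with `‖Φ‖_λ < ∞` for some `λ > 0` and some
decay function. -/
def IsShortRange (τ : ℝ → (Quasilocal N ≃⋆ₐ[ℂ] Quasilocal N)) : Prop :=
  ∃ Φ : Finset (Lattice D) → Quasilocal N, IsInteraction Φ ∧ IsDefinedBy τ Φ ∧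
    ∃ F : ℝ → ℝ, IsDecayFunction D F ∧ ∃ lam : ℝ, 0 < lam ∧ interactionNorm Φ F lam < ∞

/-! ### States -/

/-- A state: a positive linear functional of norm one. -/
structure IsState (ω : Quasilocal N →L[ℂ] ℂ) : Prop where
  nonneg : ∀ A, ∃ r : ℝ, 0 ≤ r ∧ ω (A * star A) = r
  norm_eq_one : ‖ω‖ = 1

/-- Space-like clustering for `(𝔘, ι, τ)`: there is a velocity `υ_c > 0` such that
`ω(ι_{rx} τ_{r |x| / υ}(A) B) → ω(A) ω(B)` as `r → ∞`, for all nonzero `x`, all `|υ| > υ_c` and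
all `A`, `B`. -/
def IsSpacelikeClustering (ι : Lattice D → (Quasilocal N ≃⋆ₐ[ℂ] Quasilocal N))
    (τ : ℝ → (Quasilocal N ≃⋆ₐ[ℂ] Quasilocal N)) (ω : Quasilocal N →L[ℂ] ℂ) : Prop :=
  ∃ vc : ℝ, 0 < vc ∧ ∀ x : Lattice D, x ≠ 0 → ∀ v : ℝ, vc < |v| → ∀ A B : Quasilocal N,
    Filter.Tendsto (fun r : ℕ => ω (ι (r • x) (τ (r * (v⁻¹ * normOne x)) A) * B))
      Filter.atTop (nhds (ω A * ω B))

/-- `f` is the entire continuation `z ↦ τ_z(A)` of `t ↦ τ_t(A)`; it is unique if it exists, and it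
exists exactly if `A` is an entire analytic element for `τ`. -/
def IsEntireContinuation (τ : ℝ → (Quasilocal N ≃⋆ₐ[ℂ] Quasilocal N)) (A : Quasilocal N)
    (f : ℂ → Quasilocal N) : Prop :=
  Differentiable ℂ f ∧ ∀ t : ℝ, f t = τ t A

/-- `(τ, β)`-KMS states: `ω(A τ_{iβ}(B)) = ω(B A)` for all `A`, `B` in a norm dense, `τ`-invariant
⋆-subalgebra consisting of entire analytic elements for `τ`. -/
structure IsKMS (τ : ℝ → (Quasilocal N ≃⋆ₐ[ℂ] Quasilocal N)) (β : ℝ)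
    (ω : Quasilocal N →L[ℂ] ℂ) : Prop extends IsState ω where
  kms : ∃ S : NonUnitalStarSubalgebra ℂ (Quasilocal N),
    Dense (S : Set (Quasilocal N)) ∧
    (∀ t : ℝ, ∀ A ∈ S, τ t A ∈ S) ∧
    (∀ B ∈ S, ∃ f, IsEntireContinuation τ B f ∧
      ∀ A ∈ S, ω (A * f (Complex.I * β)) = ω (B * A))

/-- `(H, π, Ω)` is the GNS representation of `ω` (which is unique up to unitary equivalence): `Ω` is
a cyclic vector for the representation `π`, and `ω(A) = ⟪Ω, π(A) Ω⟫`. -/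
structure IsGNS (ω : Quasilocal N →L[ℂ] ℂ) {H : Type*} [NormedAddCommGroup H]
    [InnerProductSpace ℂ H] [CompleteSpace H] (π : Quasilocal N →⋆ₐ[ℂ] (H →L[ℂ] H)) (Ω : H) :
    Prop where
  cyclic : Dense (Set.range fun A => π A Ω)
  state_eq : ∀ A, ω A = inner ℂ Ω (π A Ω)

end Dynamics

end

end QSL

namespace QSL

open Filter Topology MeasureTheory

/-! ### Orthogonality of resonant vectors and the mean ergodic theorem -/

section HilbertSpace

/-! Clustering makes ω invariant under space-time translations, so these act on the GNS space by
isometries W(x,t) fixing Ω. Write the direction as x/|x|. Shifting t by the period |x|/υ moves the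
floored ray by exactly x, hence the mean ergodic theorem for W(x,|x|/υ) computes the ray average on
Ω: it tends to ω(A)Ω unless W(x,|x|/υ) fixes a nonzero vector orthogonal to Ω
(`tendsto_average_of_shift`).

Such resonances are rare. Vectors orthogonal to Ω and fixed by W(x,p) and W(x,p') with p ≠ p' have
an inner product that is constant along a subsequence of some space-like ray, where clustering sends
it to 0 (`inner_eq_zero_of_fixed_of_fixed`). Since the GNS space is separable, only countably many p
are resonant, so almost every speed is good.

Finally the KMS condition turns convergence on Ω of a bounded family of observables into strong
convergence (`IsKMS.tendsto_zero`). -/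

lemma tendsto_of_lipschitzWith_of_dense {X Y ι : Type*} [PseudoMetricSpace X] [PseudoMetricSpace Y]
    {l : Filter ι} {F : ι → X → Y} {f : X → Y} {K : NNReal} (hF : ∀ i, LipschitzWith K (F i))
    (hf : Continuous f) {s : Set X} (hs : Dense s)
    (h : ∀ x ∈ s, Tendsto (fun i => F i x) l (𝓝 (f x))) (x : X) :
    Tendsto (fun i => F i x) l (𝓝 (f x)) := by
  have hc : IsClosed {x | Tendsto (fun i => F i x) l (𝓝 (f x))} :=
    (LipschitzWith.uniformEquicontinuous F K hF).equicontinuous.isClosed_setOfPred_tendsto hf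
  have := hc.closure_subset_iff.2 h
  rw [hs.closure_eq] at this
  exact this (Set.mem_univ x)

variable {H : Type*} [NormedAddCommGroup H] [InnerProductSpace ℂ H]

/-- A set of pairwise orthogonal lines in a separable space is countable. -/
lemma countable_of_pairwise_orthogonal [TopologicalSpace.SeparableSpace H] {ι : Type*}
    (P : ι → H → Prop) (hsmul : ∀ i ψ (c : ℂ), P i ψ → P i (c • ψ))
    (horth : ∀ i j ψ φ, i ≠ j → P i ψ → P j φ → inner ℂ ψ φ = 0) :
    {i | ∃ ψ, P i ψ ∧ ψ ≠ 0}.Countable := by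
  classical
  have hex : ∀ i : {i | ∃ ψ, P i ψ ∧ ψ ≠ 0}, ∃ ψ, P i ψ ∧ ‖ψ‖ = 1 := by
    rintro ⟨i, ψ, hψ, h0⟩
    exact ⟨((‖ψ‖⁻¹ : ℝ) : ℂ) • ψ, hsmul i ψ _ hψ, by simp [norm_smul, h0]⟩
  choose e he hn using hex
  rw [← Set.countable_coe_iff]
  -- Orthonormal vectors are at distance √2 > 1, so balls of radius 1/2 around them are disjoint,
  -- and a separable space has only countably many disjoint nonempty open sets.
  refine Set.countable_univ_iff.1 (Set.PairwiseDisjoint.countable_of_isOpen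
    (s := fun i => Metric.ball (e i) (1 / 2)) (a := Set.univ) ?_ (fun _ _ => Metric.isOpen_ball)
    (fun i _ => Metric.nonempty_ball.2 (by norm_num)))
  intro i _ j _ hij
  refine Metric.ball_disjoint_ball ?_
  have h : ‖e i - e j‖ * ‖e i - e j‖ = 1 + 1 := by
    rw [@norm_sub_mul_self ℂ, horth i j _ _ (fun h => hij (Subtype.ext h)) (he i) (he j), hn, hn]
    simp
  rw [dist_eq_norm]
  nlinarith [norm_nonneg (e i - e j)]

/-- Vectors invariant along two different rays are orthogonal, if matrix elements decay along the
rays `n ↦ (n, n s)` of small slope `s`. -/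
lemma inner_eq_zero_of_fixed_of_fixed (W : ℕ → ℝ → H →L[ℂ] H)
    (hadd : ∀ m n s t ψ, W (m + n) (s + t) ψ = W m s (W n t ψ))
    (hinner : ∀ n t ψ φ, inner ℂ (W n t ψ) (W n t φ) = inner ℂ ψ φ) {Ω : H} {c : ℝ} (hc : 0 < c)
    (hlim : ∀ s : ℝ, s ≠ 0 → |s| < c → ∀ ψ φ : H,
      Tendsto (fun n : ℕ => inner ℂ (W n (n * s) ψ) φ) atTop (𝓝 (inner ℂ ψ Ω * inner ℂ Ω φ)))
    {p p' : ℝ} (hp : p ≠ p') {ψ φ : H} (hψ : W 1 p ψ = ψ) (hφ : W 1 p' φ = φ)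
    (hψΩ : inner ℂ ψ Ω = 0) (hφΩ : inner ℂ φ Ω = 0) : inner ℂ ψ φ = 0 := by
  -- This quotient and the one with p, p' exchanged sum to 1, so one is positive. Positivity is
  -- needed because the rational chosen above it must be a ratio of natural numbers: W has only
  -- natural steps in its first argument.
  wlog hpos : 0 < p / (p - p') generalizing p p' ψ φ
  · rw [← inner_conj_symm, this hp.symm hφ hψ hφΩ hψΩ, map_zero]
    have h1 : p - p' ≠ 0 := sub_ne_zero.2 hp
    have h2 : p' - p ≠ 0 := sub_ne_zero.2 hp.symm
    have : p / (p - p') + p' / (p' - p) = 1 := by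
      field_simp
      ring
    linarith
  have h1 : p - p' ≠ 0 := sub_ne_zero.2 hp
  have h1' : 0 < |p - p'| := abs_pos.2 h1
  have hiter : ∀ {p : ℝ} {ψ : H}, W 1 p ψ = ψ → ∀ n : ℕ, W (n + 1) ((n + 1 : ℕ) * p) ψ = ψ := by
    intro p ψ h n
    induction n with
    | zero => simpa using h
    | succ n ih =>
      have : ((n + 1 + 1 : ℕ) : ℝ) * p = (n + 1 : ℕ) * p + p := by push_cast; ring
      rw [this, hadd, h, ih]
  have hiter' : ∀ {p : ℝ} {ψ : H}, W 1 p ψ = ψ → ∀ n : ℕ, 0 < n → W n (n * p) ψ = ψ := by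
    intro p ψ h n hn
    obtain ⟨n, rfl⟩ := Nat.exists_eq_succ_of_ne_zero hn.ne'
    exact hiter h n
  -- The slope s = p + (p' - p)ρ vanishes exactly at ρ = p/(p - p'); a rational strictly above,
  -- within c/|p - p'|, gives 0 < |s| < c.
  obtain ⟨ρ, hρ1, hρ2⟩ := exists_rat_btwn
    (show p / (p - p') < p / (p - p') + c / |p - p'| by linarith [div_pos hc h1'])
  have hρ0 : (0 : ℝ) < ρ := hpos.trans hρ1
  set s : ℝ := p + (p' - p) * ρ with hs
  have hs' : s = -((p - p') * (ρ - p / (p - p'))) := by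
    rw [hs]
    field_simp
    ring
  have hd : 0 < (ρ : ℝ) - p / (p - p') := by linarith
  have hs0 : s ≠ 0 := by
    rw [hs']
    exact neg_ne_zero.2 (mul_ne_zero h1 hd.ne')
  have hsc : |s| < c := by
    rw [hs', abs_neg, abs_mul, abs_of_pos hd]
    calc |p - p'| * (ρ - p / (p - p')) < |p - p'| * (c / |p - p'|) := by
          gcongr
          linarith
      _ = c := by field_simp
  have hnum : (0 : ℤ) < ρ.num := Rat.num_pos.2 (by exact_mod_cast hρ0)
  obtain ⟨m, hm⟩ := Int.eq_ofNat_of_zero_le hnum.le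
  have hm0 : 0 < m := by omega
  have hρ : (ρ : ℝ) * ρ.den = m := by
    have := Rat.mul_den_eq_num ρ
    rw [hm] at this
    exact_mod_cast this
  -- The pure time shift by n(p' - p) takes ψ = W(n, np)ψ to W(n, np')ψ, while φ = W(n, np')φ; the
  -- common isometry drops out.
  have hshift : ∀ n : ℕ, 0 < n → inner ℂ (W 0 (n * (p' - p)) ψ) φ = inner ℂ ψ φ := by
    intro n hn
    have e1 : W 0 (n * (p' - p)) ψ = W n (n * p') ψ := by
      conv_lhs => rw [← hiter' hψ n hn]
      rw [← hadd, zero_add]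
      congr 2
      ring
    rw [e1]
    conv_lhs => rw [← hiter' hφ n hn]
    rw [hinner]
  -- With ρ = m/d, the ray point (kd, kds) is (kd, kdp), which fixes ψ, followed by the time shift
  -- km(p' - p).
  have hconst : ∀ k : ℕ, 0 < k →
      inner ℂ (W (k * ρ.den) ((k * ρ.den : ℕ) * s) ψ) φ = inner ℂ ψ φ := by
    intro k hk
    rw [← hshift (k * m) (by positivity)]
    congr 1
    conv_rhs => rw [← hiter' hψ (k * ρ.den) (mul_pos hk ρ.den_pos)]
    rw [← hadd, zero_add]
    congr 2
    push_cast
    rw [hs, ← hρ]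
    ring
  have hl := (hlim s hs0 hsc ψ φ).comp
    (tendsto_id.atTop_mul_const' ρ.den_pos)
  rw [hψΩ, zero_mul] at hl
  refine tendsto_nhds_unique (tendsto_const_nhds.congr' ?_) hl
  filter_upwards [eventually_gt_atTop 0] with k hk
  exact (hconst k hk).symm

/-- The mean ergodic theorem in continuous time, for a function which is mapped to itself by a
contraction when time is shifted by a period `a`. -/
lemma tendsto_average_of_shift [CompleteSpace H] (U : H →L[ℂ] H) (hU : ‖U‖ ≤ 1) {Ω : H}
    (hΩ : ‖Ω‖ = 1) (hUΩ : U Ω = Ω) (hfix : ∀ ψ, U ψ = ψ → inner ℂ Ω ψ = 0 → ψ = 0)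
    {a : ℝ} (ha : 0 < a) {f : ℝ → H} (hf : ∀ S T, IntervalIntegrable f volume S T)
    (hshift : ∀ t, f (t + a) = U (f t)) {z : ℂ} (hz : ∀ t, inner ℂ Ω (f t) = z)
    {C : ℝ} (hC : ∀ t, ‖f t‖ ≤ C) :
    Tendsto (fun T : ℝ => (1 / T : ℝ) • ∫ t in (0 : ℝ)..T, f t) atTop (𝓝 (z • Ω)) := by
  set I : H := ∫ t in (0 : ℝ)..a, f t with hI
  have hC0 : 0 ≤ C := (norm_nonneg _).trans (hC 0)
  have hshiftn : ∀ n : ℕ, ∀ t, f (t + n * a) = (U^[n]) (f t) := by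
    intro n
    induction n with
    | zero => simp
    | succ n ih =>
      intro t
      rw [Function.iterate_succ_apply', ← ih, ← hshift]
      congr 1
      push_cast
      ring
  have hpow : ∀ (n : ℕ) x, (U^[n]) x = (U ^ n) x := by
    intro n x
    induction n with
    | zero => simp
    | succ n ih => rw [Function.iterate_succ_apply', ih, pow_succ']; rfl
  have hpiece : ∀ n : ℕ, ∫ t in (n * a)..((n + 1 : ℕ) * a), f t = (U^[n]) I := by
    intro n
    have e : ∫ t in (n * a)..((n + 1 : ℕ) * a), f t = ∫ t in (0 : ℝ)..a, f (t + n * a) := by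
      rw [intervalIntegral.integral_comp_add_right]
      congr 1 <;> push_cast <;> ring
    rw [e]
    simp_rw [hshiftn, hpow]
    rw [hI]
    exact ContinuousLinearMap.intervalIntegral_comp_comm (U ^ n) (hf 0 a)
  have hsum : ∀ n : ℕ, ∫ t in (0 : ℝ)..(n * a), f t = ∑ k ∈ Finset.range n, (U^[k]) I := by
    intro n
    rw [← Finset.sum_congr rfl fun k _ => hpiece k]
    have := intervalIntegral.sum_integral_adjacent_intervals (f := f) (μ := volume)
      (a := fun k : ℕ => (k : ℝ) * a) (n := n) (fun k _ => hf _ _)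
    simpa using this.symm
  have hInner : inner ℂ Ω I = a * z := by
    have : ∫ t in (0 : ℝ)..a, inner ℂ Ω (f t) = inner ℂ Ω I :=
      ContinuousLinearMap.intervalIntegral_comp_comm (innerSL ℂ Ω) (hf 0 a)
    rw [← this]
    simp [hz]
  -- The fixed space of U is spanned by Ω: the projection of I minus azΩ is fixed and orthogonal to
  -- Ω, hence zero by `hfix`.
  have hproj : (((U.eqLocus (1 : H →L[ℂ] H)).orthogonalProjectionOnto I : _) : H)
      = ((a : ℂ) * z) • Ω := by
    set K := U.eqLocus (1 : H →L[ℂ] H) with hK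
    have hmem : ∀ x, x ∈ K ↔ U x = x := fun x => Iff.rfl
    have hΩK : Ω ∈ K := (hmem _).2 hUΩ
    set P : H := ((K.orthogonalProjectionOnto I : K) : H) with hP
    have hPK : P ∈ K := SetLike.coe_mem _
    have hΩΩ : inner ℂ Ω Ω = (1 : ℂ) := by rw [inner_self_eq_norm_sq_to_K, hΩ]; simp
    have hinn : inner ℂ Ω P = (a : ℂ) * z := by
      rw [← hInner]
      exact Submodule.inner_orthogonalProjectionOnto_eq_of_mem_left (⟨Ω, hΩK⟩ : K) I
    have h0 : P - ((a : ℂ) * z) • Ω = 0 := by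
      refine hfix _ ?_ ?_
      · rw [map_sub, map_smul, hUΩ, (hmem _).1 hPK]
      · rw [inner_sub_right, inner_smul_right, hΩΩ, hinn]
        ring
    exact sub_eq_zero.1 h0
  have hbirk : Tendsto (fun n : ℕ => (n : ℂ)⁻¹ • ∫ t in (0 : ℝ)..(n * a), f t) atTop
      (𝓝 (((a : ℂ) * z) • Ω)) := by
    have := U.tendsto_birkhoffAverage_orthogonalProjection hU I
    rw [hproj] at this
    refine this.congr fun n => ?_
    rw [hsum]
    simp [birkhoffAverage, birkhoffSum]
  have hfloor : Tendsto (fun T : ℝ => ⌊T / a⌋₊) atTop atTop :=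
    tendsto_nat_floor_atTop.comp (tendsto_id.atTop_div_const ha)
  have hratio : Tendsto (fun T : ℝ => (⌊T / a⌋₊ : ℝ) / T) atTop (𝓝 a⁻¹) := by
    have := (tendsto_nat_floor_mul_div_atTop (R := ℝ) (a := a⁻¹) (by positivity))
    simpa [div_eq_inv_mul] using this
  have hmain : Tendsto (fun T : ℝ => (((⌊T / a⌋₊ : ℝ) / T : ℝ) : ℂ) • (((⌊T / a⌋₊ : ℕ) : ℂ)⁻¹ •
      ∫ t in (0 : ℝ)..(⌊T / a⌋₊ * a), f t)) atTop (𝓝 (z • Ω)) := by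
    have ha' : (a : ℂ) ≠ 0 := by exact_mod_cast ha.ne'
    have e : z • Ω = ((a⁻¹ : ℝ) : ℂ) • ((a : ℂ) * z) • Ω := by
      rw [smul_smul, Complex.ofReal_inv, inv_mul_cancel_left₀ ha']
    rw [e]
    exact ((Complex.continuous_ofReal.tendsto _).comp hratio).smul (hbirk.comp hfloor)
  -- What is left after the last full period has norm at most C a, which division by T kills.
  have hrem : Tendsto (fun T : ℝ => (1 / T : ℝ) • ∫ t in (⌊T / a⌋₊ * a)..T, f t) atTop
      (𝓝 0) := by
    have hlim : Tendsto (fun T : ℝ => C * a * T⁻¹) atTop (𝓝 0) := by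
      simpa using tendsto_inv_atTop_zero.const_mul (C * a)
    refine squeeze_zero_norm' ?_ hlim
    filter_upwards [eventually_gt_atTop 0] with T hT
    have h1 : (⌊T / a⌋₊ : ℝ) * a ≤ T := by
      rw [← le_div_iff₀ ha]
      exact Nat.floor_le (by positivity)
    have h2 : T ≤ (⌊T / a⌋₊ : ℝ) * a + a := by
      have := (Nat.lt_floor_add_one (T / a)).le
      rw [div_le_iff₀ ha] at this
      linarith
    rw [norm_smul, Real.norm_of_nonneg (by positivity), one_div, mul_comm]
    gcongr
    calc ‖∫ t in (⌊T / a⌋₊ * a)..T, f t‖ ≤ C * |T - ⌊T / a⌋₊ * a| :=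
          intervalIntegral.norm_integral_le_of_norm_le_const fun t _ => hC t
      _ ≤ C * a := by
          rw [abs_of_nonneg (by linarith)]
          gcongr
          linarith
  have := hmain.add hrem
  rw [add_zero] at this
  refine this.congr' ?_
  filter_upwards [hfloor.eventually (eventually_gt_atTop 0), eventually_gt_atTop 0] with T hT hT0
  rw [← intervalIntegral.integral_add_adjacent_intervals (hf 0 (⌊T / a⌋₊ * a)) (hf _ T), smul_add,
    smul_smul]
  congr 1
  rw [← Complex.coe_smul]
  congr 1
  have : ((⌊T / a⌋₊ : ℕ) : ℂ) ≠ 0 := by exact_mod_cast hT.ne'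
  push_cast
  field_simp

end HilbertSpace

/-! ### Separability of the quasi-local algebra -/

section Separability

/-- The words in s and its adjoints form a countable monoid, and the generated star algebra is their
linear span. -/
lemma isSeparable_adjoin {A : Type*} [Semiring A] [Algebra ℂ A] [StarRing A] [StarModule ℂ A]
    [TopologicalSpace A] [ContinuousAdd A] [ContinuousSMul ℂ A] {s : Set A} (hs : s.Countable) :
    TopologicalSpace.IsSeparable (StarAlgebra.adjoin ℂ s : Set A) := by
  have hs' : (s ∪ star s).Countable :=
    hs.union (by rw [← Set.image_star]; exact hs.image _)
  have hcl : (Submonoid.closure (s ∪ star s) : Set A).Countable := by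
    have := hs'.to_subtype
    have : Countable (FreeMonoid (s ∪ star s : Set A)) :=
      inferInstanceAs (Countable (List (s ∪ star s : Set A)))
    rw [Submonoid.closure_eq_mrange, MonoidHom.coe_mrange]
    exact Set.countable_range _
  have h : (StarAlgebra.adjoin ℂ s : Set A) =
      (Submodule.span ℂ (Submonoid.closure (s ∪ star s) : Set A) : Set A) := by
    rw [← Algebra.adjoin_eq_span]
    rfl
  rw [h]
  exact hcl.isSeparable.span

variable {D : ℕ}

lemma quasiLocalOps_le (N : Lattice D → ℕ) : quasiLocalOps N ≤
    (StarAlgebra.adjoin ℂ (Set.range fun p : Σ x : Lattice D, Fin (N x) × Fin (N x) =>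
      siteUnit (N := N) p.1 p.2.1 p.2.2)).topologicalClosure := by
  refine StarSubalgebra.topologicalClosure_mono (iSup_le fun Λ => iSup₂_le fun x _ => ?_)
  rintro _ ⟨M, rfl⟩
  change siteOp x M ∈ _
  refine sum_mem fun i _ => sum_mem fun j _ => SMulMemClass.smul_mem _ ?_
  exact StarAlgebra.subset_adjoin ℂ _ ⟨⟨x, i, j⟩, rfl⟩

/-- Countably many matrix units generate a dense subalgebra. Separability is used twice: for the
countability of resonances and for strong measurability of the orbits. -/
instance separableSpace_quasilocal (N : Lattice D → ℕ) :
    TopologicalSpace.SeparableSpace (Quasilocal N) := by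
  have h := (isSeparable_adjoin (Set.countable_range
    fun p : Σ x : Lattice D, Fin (N x) × Fin (N x) =>
      siteUnit (N := N) p.1 p.2.1 p.2.2)).closure.mono (quasiLocalOps_le N)
  exact h.separableSpace

end Separability

/-! ### Space-like clustering and invariance of the state -/

section GNS

variable {D : ℕ} {N : Lattice D → ℕ} {ι : Lattice D → (Quasilocal N ≃⋆ₐ[ℂ] Quasilocal N)}
  {τ : ℝ → (Quasilocal N ≃⋆ₐ[ℂ] Quasilocal N)} {ω : Quasilocal N →L[ℂ] ℂ}
  {H : Type*} [NormedAddCommGroup H] [InnerProductSpace ℂ H] [CompleteSpace H]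
  {π : Quasilocal N →⋆ₐ[ℂ] (H →L[ℂ] H)} {Ω : H}

lemma normOne_pos {x : Lattice D} (hx : x ≠ 0) : 0 < normOne x := by
  obtain ⟨i, hi⟩ := Function.ne_iff.1 hx
  exact Finset.sum_pos' (fun i _ => abs_nonneg _)
    ⟨i, Finset.mem_univ i, abs_pos.2 (by exact_mod_cast hi)⟩

/-- Space-like clustering along the rays `r ↦ (r x, r s)` of small slope. -/
lemma IsSpacelikeClustering.exists_slope (hω : IsSpacelikeClustering ι τ ω) {x : Lattice D}
    (hx : x ≠ 0) : ∃ c : ℝ, 0 < c ∧ ∀ s : ℝ, s ≠ 0 → |s| < c → ∀ A B : Quasilocal N,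
      Tendsto (fun r : ℕ => ω (ι (r • x) (τ (r * s) A) * B)) atTop (𝓝 (ω A * ω B)) := by
  obtain ⟨vc, hvc, hlim⟩ := hω
  have hxp := normOne_pos hx
  -- Slope s is speed |x|/s, so exceeding the critical speed means |s| < |x|/`vc`; s = 0 would be
  -- infinite speed, which clustering does not cover.
  refine ⟨normOne x / vc, by positivity, fun s hs hsc A B => ?_⟩
  have hv : vc < |normOne x / s| := by
    rw [abs_div, abs_of_pos hxp, lt_div_iff₀ (abs_pos.2 hs), mul_comm]
    exact (lt_div_iff₀ hvc).1 hsc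
  have e : (normOne x / s)⁻¹ * normOne x = s := by field_simp
  have h := hlim x hx _ hv A B
  rwa [e] at h

/-- Space-like clustering states are invariant under space and time translations. -/
lemma IsSpacelikeClustering.invariant (hω : IsSpacelikeClustering ι τ ω)
    (hτ : IsLatticeSystem ι τ) (hω1 : ω 1 = 1) {x₀ : Lattice D} (hx₀ : x₀ ≠ 0) (x : Lattice D)
    (t : ℝ) (A : Quasilocal N) : ω (ι x (τ t A)) = ω A := by
  have hray : ∀ x : Lattice D, x ≠ 0 → ∃ c : ℝ, 0 < c ∧ ∀ s : ℝ, s ≠ 0 → |s| < c →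
      ∀ A, ω (ι x (τ s A)) = ω A := by
    intro x hx
    -- Clustering with B = 1; replacing A by its translate along the ray only shifts the sequence by
    -- one index.
    obtain ⟨c, hc, hlim⟩ := hω.exists_slope hx
    refine ⟨c, hc, fun s hs hsc A => ?_⟩
    have hl : ∀ A, Tendsto (fun r : ℕ => ω (ι (r • x) (τ (r * s) A))) atTop (𝓝 (ω A)) := by
      intro A
      have := hlim s hs hsc A 1
      simpa only [mul_one, hω1] using this
    refine (tendsto_nhds_unique ((hl A).comp (tendsto_add_atTop_nat 1))
      ((hl _).congr fun r => ?_)).symm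
    simp only [Function.comp]
    rw [hτ.homogeneous, ← hτ.time_add, ← hτ.space_add]
    congr 3
    · rw [add_smul, one_smul]
    · push_cast; ring_nf
  have htime : ∀ t A, ω (τ t A) = ω A := by
    obtain ⟨c, hc, h⟩ := hray x₀ hx₀
    -- Invariance along the slopes c/2 and c/2 + r, applied to one element: the space translations
    -- cancel and time r remains. The bound c/4 keeps both slopes nonzero and below c.
    have hsmall : ∀ r : ℝ, |r| < c / 4 → ∀ A, ω (τ r A) = ω A := by
      intro r hr A
      have hr' := abs_lt.1 hr
      have h1 := h (c / 2) (by positivity) (by rw [abs_lt]; constructor <;> linarith)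
        (ι (-x₀) (τ (-(c / 2)) A))
      have h2 := h (c / 2 + r) (by linarith) (by rw [abs_lt]; constructor <;> linarith)
        (ι (-x₀) (τ (-(c / 2)) A))
      rw [hτ.homogeneous, ← hτ.space_add, ← hτ.time_add, add_neg_cancel, hτ.space_zero] at h1 h2
      rw [add_neg_cancel, hτ.time_zero] at h1
      rw [h1, ← h2]
      congr 2
      ring_nf
    intro t A
    obtain ⟨n, hn⟩ := exists_nat_gt (|t| / (c / 4))
    have hn0 : (0 : ℝ) < n := lt_of_le_of_lt (by positivity) hn
    have hr : |t / n| < c / 4 := by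
      rw [abs_div, abs_of_pos hn0, div_lt_iff₀ hn0]
      rw [div_lt_iff₀ (by positivity)] at hn
      linarith
    have hit : ∀ k : ℕ, ω (τ (k * (t / n)) A) = ω A := by
      intro k
      induction k with
      | zero => simp [hτ.time_zero]
      | succ k ih =>
        rw [← ih, ← hsmall _ hr (τ (k * (t / n)) A), ← hτ.time_add]
        congr 2
        push_cast
        ring_nf
    rw [← hit n]
    congr 2
    field_simp
  by_cases hx : x = 0
  · rw [hx, hτ.space_zero, htime]
  · obtain ⟨c, hc, h⟩ := hray x hx
    have h1 := h (c / 2) (by positivity) (by rw [abs_lt]; constructor <;> linarith)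
      (τ (t - c / 2) A)
    rw [← hτ.time_add, htime] at h1
    rw [← h1]
    congr 3
    ring_nf

/-! ### Translations on the GNS space -/

lemma IsGNS.inner_eq (hGNS : IsGNS ω π Ω) (A B : Quasilocal N) :
    inner ℂ (π A Ω) (π B Ω) = ω (star A * B) := by
  rw [hGNS.state_eq, map_mul, map_star, ContinuousLinearMap.star_eq_adjoint,
    mul_apply_eq_comp, ContinuousLinearMap.adjoint_inner_right]

/-- As π is contractive, ‖ω‖ ≤ ‖Ω‖²; evaluating ω at 1 gives the reverse bound. This recovers ω(1) =
1 from the normalisation of ‖ω‖. -/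
lemma IsGNS.norm_eq_one (hGNS : IsGNS ω π Ω) (hω : ‖ω‖ = 1) : ‖Ω‖ = 1 := by
  have hone : ω 1 = (‖Ω‖ ^ 2 : ℝ) := by
    rw [hGNS.state_eq, map_one, one_apply_eq_self, inner_self_eq_norm_sq_to_K]
    norm_cast
  have hle : ‖ω‖ ≤ ‖Ω‖ ^ 2 := by
    refine ω.opNorm_le_bound (by positivity) fun A => ?_
    rw [hGNS.state_eq]
    calc ‖inner ℂ Ω (π A Ω)‖ ≤ ‖Ω‖ * (‖π A‖ * ‖Ω‖) :=
          (norm_inner_le_norm _ _).trans (by gcongr; exact (π A).le_opNorm _)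
      _ ≤ ‖Ω‖ * (‖A‖ * ‖Ω‖) := by
          gcongr
          exact NonUnitalStarAlgHom.norm_apply_le π A
      _ = ‖Ω‖ ^ 2 * ‖A‖ := by ring
  have hge : ‖Ω‖ ^ 2 ≤ 1 := by
    have h1 := ω.le_opNorm 1
    have h2 : ‖(1 : Quasilocal N)‖ ≤ 1 := by
      have : ‖(1 : ConfigSpace N →L[ℂ] ConfigSpace N)‖ ≤ 1 := ContinuousLinearMap.norm_id_le
      exact this
    rw [hone, Complex.norm_real, Real.norm_of_nonneg (by positivity), hω, one_mul] at h1
    linarith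
  have : ‖Ω‖ ^ 2 = 1 := by linarith
  nlinarith [norm_nonneg Ω]

lemma IsGNS.apply_one (hGNS : IsGNS ω π Ω) (hω : ‖ω‖ = 1) : ω 1 = 1 := by
  rw [hGNS.state_eq, map_one, one_apply_eq_self, inner_self_eq_norm_sq_to_K,
    hGNS.norm_eq_one hω]
  simp

lemma IsGNS.denseRange (hGNS : IsGNS ω π Ω) : DenseRange fun A => π A Ω := hGNS.cyclic

lemma continuous_vector_orbit (π : Quasilocal N →⋆ₐ[ℂ] (H →L[ℂ] H)) (Ω : H) :
    Continuous fun A => π A Ω :=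
  (AddMonoidHomClass.continuous_of_bound π 1 fun A => by
    simpa using NonUnitalStarAlgHom.norm_apply_le π A).clm_apply continuous_const

lemma IsGNS.separableSpace (hGNS : IsGNS ω π Ω) : TopologicalSpace.SeparableSpace H :=
  hGNS.denseRange.separableSpace (continuous_vector_orbit π Ω)

/-- A symmetry of the state is implemented by an isometry of the GNS space. -/
lemma IsGNS.exists_implementation (hGNS : IsGNS ω π Ω) (α : Quasilocal N ≃⋆ₐ[ℂ] Quasilocal N)
    (hα : ∀ A, ω (α A) = ω A) : ∃ U : H →L[ℂ] H, ∀ A, U (π A Ω) = π (α A) Ω := by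
  let e : Quasilocal N →ₗ[ℂ] H :=
    { toFun := fun A => π A Ω
      map_add' := fun A B => by simp
      map_smul' := fun c A => by simp }
  let f : Quasilocal N →ₗ[ℂ] H :=
    { toFun := fun A => π (α A) Ω
      map_add' := fun A B => by simp
      map_smul' := fun c A => by simp }
  have hnorm : ∃ C, ∀ A, ‖f A‖ ≤ C * ‖e A‖ := by
    refine ⟨1, fun A => ?_⟩
    have h : inner ℂ (f A) (f A) = (inner ℂ (e A) (e A) : ℂ) := by
      change inner ℂ (π (α A) Ω) (π (α A) Ω) = inner ℂ (π A Ω) (π A Ω)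
      rw [hGNS.inner_eq, hGNS.inner_eq, ← map_star, ← map_mul, hα]
    rw [one_mul, @norm_eq_sqrt_re_inner ℂ, @norm_eq_sqrt_re_inner ℂ _ _ _ _ (e A), h]
  exact ⟨f.extendOfNorm e, LinearMap.extendOfNorm_eq (e := e) hGNS.denseRange hnorm⟩

/-- Space-time translations are implemented by a unitary representation on the GNS space. -/
lemma IsGNS.exists_translations (hGNS : IsGNS ω π Ω) (hτ : IsLatticeSystem ι τ)
    (hinv : ∀ x t A, ω (ι x (τ t A)) = ω A) :
    ∃ W : Lattice D → ℝ → H →L[ℂ] H, (∀ x t A, W x t (π A Ω) = π (ι x (τ t A)) Ω) ∧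
      (∀ x y s t ψ, W (x + y) (s + t) ψ = W x s (W y t ψ)) ∧ (∀ ψ, W 0 0 ψ = ψ) ∧
      (∀ x t ψ φ, inner ℂ (W x t ψ) (W x t φ) = inner ℂ ψ φ) ∧ ∀ x t, W x t Ω = Ω := by
  choose W hW using fun x t => hGNS.exists_implementation ((τ t).trans (ι x)) (hinv x t)
  have hW' : ∀ x t A, W x t (π A Ω) = π (ι x (τ t A)) Ω := hW
  refine ⟨W, hW', fun x y s t ψ => ?_, fun ψ => ?_, fun x t ψ φ => ?_, fun x t => ?_⟩
  · refine hGNS.denseRange.induction_on ψ (isClosed_eq (by fun_prop) (by fun_prop)) fun A => ?_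
    simp only [hW']
    rw [hτ.homogeneous, ← hτ.time_add, ← hτ.space_add]
  · refine hGNS.denseRange.induction_on ψ (isClosed_eq (by fun_prop) (by fun_prop)) fun A => ?_
    simp only [hW', hτ.time_zero, hτ.space_zero]
  · refine hGNS.denseRange.induction_on₂ (isClosed_eq (by fun_prop) (by fun_prop))
      (fun A B => ?_) ψ φ
    simp only [hW']
    rw [hGNS.inner_eq, hGNS.inner_eq, ← map_star, ← map_star, ← map_mul, ← map_mul, hinv]
  · have := hW' x t 1
    simpa using this

/-- Clustering of the matrix elements of the translations along rays of small slope. -/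
lemma IsGNS.exists_slope (hGNS : IsGNS ω π Ω) (hω : IsSpacelikeClustering ι τ ω)
    {x : Lattice D} (hx : x ≠ 0) {W : Lattice D → ℝ → H →L[ℂ] H}
    (hW : ∀ x t A, W x t (π A Ω) = π (ι x (τ t A)) Ω)
    (hinner : ∀ x t ψ φ, inner ℂ (W x t ψ) (W x t φ) = inner ℂ ψ φ) :
    ∃ c : ℝ, 0 < c ∧ ∀ s : ℝ, s ≠ 0 → |s| < c → ∀ ψ φ : H,
      Tendsto (fun n : ℕ => inner ℂ (W (n • x) (n * s) ψ) φ) atTop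
        (𝓝 (inner ℂ ψ Ω * inner ℂ Ω φ)) := by
  obtain ⟨c, hc, h⟩ := hω.exists_slope hx
  have hnorm : ∀ x t ψ, ‖W x t ψ‖ = ‖ψ‖ := fun x t ψ => by
    rw [@norm_eq_sqrt_re_inner ℂ, hinner, ← @norm_eq_sqrt_re_inner ℂ]
  refine ⟨c, hc, fun s hs hsc ψ φ => ?_⟩
  refine tendsto_of_lipschitzWith_of_dense (K := ‖φ‖₊)
    (F := fun (n : ℕ) ψ => inner ℂ (W (n • x) (n * s) ψ) φ)
    (f := fun ψ => inner ℂ ψ Ω * inner ℂ Ω φ) (fun n => ?_) (by fun_prop) hGNS.denseRange ?_ ψ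
  · refine LipschitzWith.of_dist_le_mul fun ψ ψ' => ?_
    rw [dist_eq_norm, dist_eq_norm, ← inner_sub_left, ← map_sub]
    refine (norm_inner_le_norm _ _).trans ?_
    rw [hnorm, coe_nnnorm, mul_comm]
  rintro _ ⟨A, rfl⟩
  refine tendsto_of_lipschitzWith_of_dense (K := ‖π A Ω‖₊)
    (F := fun (n : ℕ) φ => inner ℂ (W (n • x) (n * s) (π A Ω)) φ)
    (f := fun φ => inner ℂ (π A Ω) Ω * inner ℂ Ω φ) (fun n => ?_) (by fun_prop)
    hGNS.denseRange ?_ φ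
  · refine LipschitzWith.of_dist_le_mul fun φ φ' => ?_
    rw [dist_eq_norm, dist_eq_norm, ← inner_sub_right]
    refine (norm_inner_le_norm _ _).trans ?_
    rw [hnorm, coe_nnnorm]
  rintro _ ⟨B, rfl⟩
  have e1 : inner ℂ (π A Ω) Ω = ω (star A) := by
    have := hGNS.inner_eq A 1
    simpa using this
  simp only [e1, ← hGNS.state_eq, hW]
  -- The adjoint appears because the inner product is conjugate linear in its first slot.
  refine (h s hs hsc (star A) B).congr fun r => ?_
  rw [hGNS.inner_eq, map_star, map_star]

/-! ### From the vacuum vector to all vectors -/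

/-- For KMS states the vacuum vector is separating in a strong sense: a bounded net of observables
which tends to zero on the vacuum vector tends to zero strongly. -/
lemma IsKMS.tendsto_zero (hGNS : IsGNS ω π Ω) {τ' : ℝ → (Quasilocal N ≃⋆ₐ[ℂ] Quasilocal N)} {β : ℝ}
    (hKMS : IsKMS τ' β ω) {J : Type*} {l : Filter J} {M : J → Quasilocal N} {C : ℝ}
    (hM : ∀ j, ‖M j‖ ≤ C) (h : Tendsto (fun j => π (M j) Ω) l (𝓝 0)) (ψ : H) :
    Tendsto (fun j => π (M j) ψ) l (𝓝 0) := by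
  obtain ⟨S, hSd, -, hS⟩ := hKMS.kms
  have hC : ∀ j, ‖π (M j)‖ ≤ max C 0 := fun j =>
    (NonUnitalStarAlgHom.norm_apply_le π (M j)).trans ((hM j).trans (le_max_left _ _))
  have hdense : Dense ((fun A => π A Ω) '' (S : Set (Quasilocal N))) :=
    hGNS.denseRange.dense_image (continuous_vector_orbit π Ω) hSd
  refine tendsto_of_lipschitzWith_of_dense (K := ⟨max C 0, le_max_right _ _⟩)
    (F := fun j ψ => π (M j) ψ) (f := fun _ => (0 : H)) (fun j => ?_) continuous_const hdense ?_ ψ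
  · refine LipschitzWith.of_dist_le_mul fun ψ ψ' => ?_
    rw [dist_eq_norm, dist_eq_norm, ← map_sub]
    exact (π (M j)).le_of_opNorm_le (hC j) _
  rintro _ ⟨B, hB, rfl⟩
  -- With E the continuation of B* to iβ, ω(B* X) = ω(X E). Hence ‖π(MB)Ω‖² = ω(B*M*MB) = ω(M*MBE) =
  -- ⟨π(M)Ω, π(M)π(BE)Ω⟩, which is controlled by ‖π(M)Ω‖.
  obtain ⟨f, -, hf⟩ := hS (star B) (star_mem hB)
  set E := f (Complex.I * β) with hE
  have hkms : ∀ A, ω (A * E) = ω (star B * A) := by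
    intro A
    refine hSd.induction (fun A hA => hf A hA) (isClosed_eq (by fun_prop) (by fun_prop)) A
  have hbound : ∀ j, ‖π (M j) (π B Ω)‖ ^ 2 ≤ ‖π (M j) Ω‖ * (max C 0 * ‖π (B * E) Ω‖) := by
    intro j
    have e1 : (inner ℂ (π (M j) (π B Ω)) (π (M j) (π B Ω)) : ℂ) =
        inner ℂ (π (M j) Ω) (π (M j) (π (B * E) Ω)) := by
      simp only [← mul_apply_eq_comp, ← map_mul]
      rw [hGNS.inner_eq, hGNS.inner_eq, star_mul, mul_assoc, ← hkms]
      simp only [mul_assoc]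
    have e2 := congrArg norm e1
    rw [inner_self_eq_norm_sq_to_K, norm_pow, RCLike.norm_ofReal, abs_norm] at e2
    rw [e2]
    refine (norm_inner_le_norm _ _).trans ?_
    gcongr
    exact (π (M j)).le_of_opNorm_le (hC j) _
  have hsq : Tendsto (fun j => ‖π (M j) (π B Ω)‖ ^ 2) l (𝓝 0) :=
    squeeze_zero (fun j => by positivity) hbound (by simpa using h.norm.mul_const _)
  refine tendsto_zero_iff_norm_tendsto_zero.2 ?_
  have := hsq.sqrt
  simpa [Real.sqrt_sq] using this

/-! ### Ray averages on the vacuum vector -/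

/-- The lattice is countable and each orbit at a fixed site is norm continuous, so the map is
jointly measurable; separability of the algebra upgrades this to strong measurability. -/
lemma stronglyMeasurable_translate (hτ : IsLatticeSystem ι τ) {c : ℝ → Lattice D}
    (hc : Measurable c) (A : Quasilocal N) : StronglyMeasurable fun t => ι (c t) (τ t A) := by
  borelize (Quasilocal N)
  have hiso : ∀ x, Isometry (ι x) := fun x =>
    AddMonoidHomClass.isometry_of_norm (ι x) (StarAlgEquiv.norm_map (ι x))
  have h : Measurable fun p : Lattice D × ℝ => ι p.1 (τ p.2 A) :=
    measurable_from_prod_countable_right fun x =>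
      ((hiso x).continuous.comp (hτ.time_continuous A)).measurable
  have : SecondCountableTopology (Quasilocal N) := UniformSpace.secondCountable_of_separable _
  exact (h.comp (hc.prodMk measurable_id)).stronglyMeasurable

lemma measurable_floorVec_ray (v : Fin D → ℝ) : Measurable fun t : ℝ => floorVec (t • v) := by
  refine measurable_pi_iff.2 fun i => Int.measurable_floor.comp ?_
  simp only [Pi.smul_apply, smul_eq_mul]
  fun_prop

/-- Convergence of the ray averages on the vacuum vector, for speeds without resonance. -/
lemma IsGNS.tendsto_average_vacuum (hGNS : IsGNS ω π Ω) (hΩ : ‖Ω‖ = 1)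
    {W : Lattice D → ℝ → H →L[ℂ] H}
    (hW : ∀ x t A, W x t (π A Ω) = π (ι x (τ t A)) Ω)
    (hadd : ∀ x y s t ψ, W (x + y) (s + t) ψ = W x s (W y t ψ)) (hzero : ∀ ψ, W 0 0 ψ = ψ)
    (hinner : ∀ x t ψ φ, inner ℂ (W x t ψ) (W x t φ) = inner ℂ ψ φ) (hWΩ : ∀ x t, W x t Ω = Ω)
    {x : Lattice D} {υ : ℝ} (hx : x ≠ 0) (hυ : υ ≠ 0)
    (hfix : ∀ ψ, W x (normOne x / υ) ψ = ψ → inner ℂ ψ Ω = 0 → ψ = 0) (A : Quasilocal N)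
    (hF : ∀ S T, IntervalIntegrable
      (fun t => ι (floorVec (t • υ • fun i => (x i : ℝ) / normOne x)) (τ t A)) volume S T) :
    Tendsto (fun T : ℝ => π ((1 / T : ℝ) • ∫ t in (0 : ℝ)..T,
      ι (floorVec (t • υ • fun i => (x i : ℝ) / normOne x)) (τ t A)) Ω) atTop (𝓝 (ω A • Ω)) := by
  set c : ℝ → Lattice D := fun t => floorVec (t • υ • fun i => (x i : ℝ) / normOne x) with hc
  have hx0 := normOne_pos hx
  have hnorm : ∀ x t ψ, ‖W x t ψ‖ = ‖ψ‖ := fun x t ψ => by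
    rw [@norm_eq_sqrt_re_inner ℂ, hinner, ← @norm_eq_sqrt_re_inner ℂ]
  let φ : Quasilocal N →L[ℝ] H :=
    { toFun := fun B => π B Ω
      map_add' := fun B C => by simp
      map_smul' := fun r B => by
        rw [← Complex.coe_smul, map_smul]
        simp
      cont := continuous_vector_orbit π Ω }
  -- The period must be positive, so for υ < 0 the inverse translation (-x, -|x|/υ) is used; its
  -- fixed vectors are also fixed by the original one.
  obtain ⟨y, a, ha, hya, hcy⟩ : ∃ (y : Lattice D) (a : ℝ), 0 < a ∧
      (∀ ψ, W y a ψ = ψ → W x (normOne x / υ) ψ = ψ) ∧ ∀ t, c (t + a) = y + c t := by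
    rcases lt_or_gt_of_ne hυ with h | h
    · refine ⟨-x, -(normOne x / υ), by rw [neg_pos]; exact div_neg_of_pos_of_neg hx0 h,
        fun ψ hψ => ?_, fun t => ?_⟩
      · conv_lhs => rw [← hψ]
        rw [← hadd, add_neg_cancel, add_neg_cancel, hzero]
      · ext i
        simp only [hc, floorVec, Pi.smul_apply, smul_eq_mul, Pi.add_apply, Pi.neg_apply]
        rw [← Int.floor_intCast_add]
        congr 1
        push_cast
        field_simp
        ring
    · refine ⟨x, normOne x / υ, by positivity, fun ψ hψ => hψ, fun t => ?_⟩
      ext i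
      simp only [hc, floorVec, Pi.smul_apply, smul_eq_mul, Pi.add_apply]
      rw [← Int.floor_intCast_add]
      congr 1
      field_simp
      ring
  have key := tendsto_average_of_shift (W y a)
    ((W y a).opNorm_le_bound zero_le_one fun ψ => by rw [hnorm, one_mul]) hΩ (hWΩ y a)
    (fun ψ hψ h0 => hfix ψ (hya ψ hψ) (inner_eq_zero_symm.1 h0)) ha
    (f := fun t => φ (ι (c t) (τ t A))) (z := ω A) (C := ‖π A Ω‖)
    (fun S T => ⟨φ.integrable_comp (hF S T).1, φ.integrable_comp (hF S T).2⟩) (fun t => ?_) (fun t => ?_) (fun t => ?_)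
  · refine key.congr fun T => ?_
    rw [φ.intervalIntegral_comp_comm (hF 0 T), ← map_smul]
    rfl
  · change π _ Ω = W y a (π _ Ω)
    rw [← hW, ← hW, ← hadd, hcy, add_comm a]
  · change inner ℂ Ω (π _ Ω) = ω A
    rw [← hW, hGNS.state_eq, ← hinner (c t) t Ω (π A Ω), hWΩ]
  · change ‖π _ Ω‖ ≤ _
    rw [← hW, hnorm]

end GNS

end QSL

/-! ### Almost every speed is non-resonant -/

theorem mainTheorem3 {D : ℕ} (N : QSL.Lattice D → ℕ) (hN : ∀ x, 0 < N x)
    (hNbdd : ∃ K : ℕ, ∀ x, N x ≤ K)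
    (ι : QSL.Lattice D → (QSL.Quasilocal N ≃⋆ₐ[ℂ] QSL.Quasilocal N))
    (τ τ' : ℝ → (QSL.Quasilocal N ≃⋆ₐ[ℂ] QSL.Quasilocal N))
    (hτ : QSL.IsLatticeSystem ι τ) (hτ' : QSL.IsLatticeSystem ι τ')
    (hτ_short : QSL.IsShortRange τ) (hτ'_short : QSL.IsShortRange τ')
    (hcomm : ∀ s t A, τ s (τ' t A) = τ' t (τ s A))
    (β : ℝ) (ω : QSL.Quasilocal N →L[ℂ] ℂ) (hKMS : QSL.IsKMS τ' β ω)
    (hω : QSL.IsSpacelikeClustering ι τ ω)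
    {H : Type*} [NormedAddCommGroup H] [InnerProductSpace ℂ H] [CompleteSpace H]
    (π : QSL.Quasilocal N →⋆ₐ[ℂ] (H →L[ℂ] H)) (Ω : H) (hGNS : QSL.IsGNS ω π Ω)
    (A : QSL.Quasilocal N) (q : Fin D → ℝ) (hq : q ∈ QSL.rationalSphere D) :
    ∀ᵐ υ : ℝ,
      (∀ T : ℝ, IntervalIntegrable (fun t => π (ι (QSL.floorVec (t • υ • q)) (τ t A)))
        MeasureTheory.volume 0 T) ∧
      ∀ Ψ : H, Filter.Tendsto
        (fun T : ℝ =>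
          ((1 / T : ℝ) • ∫ t in (0 : ℝ)..T, π (ι (QSL.floorVec (t • υ • q)) (τ t A))) Ψ)
        Filter.atTop (nhds (ω A • Ψ)) := by
  open Filter Topology MeasureTheory QSL in
  obtain ⟨x, hx, rfl⟩ := hq
  have hΩ := hGNS.norm_eq_one hKMS.norm_eq_one
  have hinv := hω.invariant hτ (hGNS.apply_one hKMS.norm_eq_one) hx
  obtain ⟨W, hW, hadd, hzero, hinner, hWΩ⟩ := hGNS.exists_translations hτ hinv
  obtain ⟨c, hc, hlim⟩ := hGNS.exists_slope hω hx hW hinner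
  have := hGNS.separableSpace
  have hcount := countable_of_pairwise_orthogonal
    (fun (p : ℝ) ψ => W x p ψ = ψ ∧ inner ℂ ψ Ω = 0)
    (fun p ψ z h => ⟨by rw [map_smul, h.1], by rw [inner_smul_left, h.2, mul_zero]⟩)
    (fun p p' ψ φ hp h h' => inner_eq_zero_of_fixed_of_fixed (fun n t => W (n • x) t)
      (fun m n s t ψ => by rw [add_smul, hadd]) (fun n => hinner _) hc hlim hp
      (by rw [one_smul]; exact h.1) (by rw [one_smul]; exact h'.1) h.2 h'.2)
  -- Injectivity makes the preimage of the countable set of resonant p countable, hence null. It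
  -- holds at υ = 0 too, as division by zero gives 0.
  have hinj : Function.Injective fun υ : ℝ => normOne x / υ := fun υ υ' h => by
    simpa [div_eq_mul_inv, (normOne_pos hx).ne'] using h
  filter_upwards [(hcount.preimage_of_injOn hinj.injOn).ae_notMem volume,
    (Set.countable_singleton (0 : ℝ)).ae_notMem volume] with υ hυ hυ0
  have hnorm : ∀ t, ‖ι (floorVec (t • υ • fun i => (x i : ℝ) / normOne x)) (τ t A)‖ = ‖A‖ :=
    fun t => by rw [StarAlgEquiv.norm_map, StarAlgEquiv.norm_map]
  have hF : ∀ S T, IntervalIntegrable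
      (fun t => ι (floorVec (t • υ • fun i => (x i : ℝ) / normOne x)) (τ t A)) volume S T :=
    fun S T => (intervalIntegrable_const (c := ‖A‖)).mono_fun
      (stronglyMeasurable_translate hτ (measurable_floorVec_ray _) A).aestronglyMeasurable
      (ae_of_all _ fun t => by simp [hnorm])
  -- The integral is formed in the separable algebra and carried into B(H) by this bounded map.
  let πL : Quasilocal N →L[ℝ] (H →L[ℂ] H) :=
    { toFun := π
      map_add' := map_add π
      map_smul' := fun r B => by
        rw [← Complex.coe_smul, map_smul]
        rfl
      cont := AddMonoidHomClass.continuous_of_bound π 1 fun A => by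
        simpa using NonUnitalStarAlgHom.norm_apply_le π A }
  have hsub : ∀ B, π (B - ω A • 1) = π B - ω A • 1 := fun B => by
    rw [map_sub, map_smul, map_one]
  refine ⟨fun T => ⟨πL.integrable_comp (hF 0 T).1, πL.integrable_comp (hF 0 T).2⟩, fun Ψ => ?_⟩
  have hvac := hGNS.tendsto_average_vacuum hΩ hW hadd hzero hinner hWΩ hx
    (by simpa using hυ0) (fun ψ h h0 => by
      by_contra hne
      exact hυ ⟨ψ, ⟨h, h0⟩, hne⟩) A hF
  have hzeroΩ := hKMS.tendsto_zero hGNS (l := atTop) (C := ‖A‖ + ‖ω A • (1 : Quasilocal N)‖)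
    (M := fun T : ℝ => (1 / T : ℝ) • (∫ t in (0 : ℝ)..T,
      ι (floorVec (t • υ • fun i => (x i : ℝ) / normOne x)) (τ t A)) - ω A • 1)
    (fun T => ?_) ?_ Ψ
  · have h := hzeroΩ.add_const (ω A • Ψ)
    rw [zero_add] at h
    refine h.congr fun T => ?_
    have e : (∫ t in (0 : ℝ)..T, π (ι (floorVec (t • υ • fun i => (x i : ℝ) / normOne x)) (τ t A)))
        = πL (∫ t in (0 : ℝ)..T,
          ι (floorVec (t • υ • fun i => (x i : ℝ) / normOne x)) (τ t A)) :=
      πL.intervalIntegral_comp_comm (hF 0 T)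
    rw [e, ← map_smul, hsub]
    simp only [sub_apply, smul_apply, one_apply_eq_self, sub_add_cancel]
    rfl
  · refine (norm_sub_le _ _).trans (add_le_add_left ?_ _)
    rw [norm_smul]
    have h := intervalIntegral.norm_integral_le_of_norm_le_const (a := 0) (b := T)
      fun t _ => (hnorm t).le
    -- The uniform bound is needed for every real T; at T = 0 the average is 0 because 1/0 = 0.
    rcases eq_or_ne T 0 with rfl | hT
    · simp
    · calc _ ≤ ‖1 / T‖ * (‖A‖ * |T - 0|) := by gcongr
        _ = ‖A‖ := by
          rw [sub_zero, norm_div, norm_one, Real.norm_eq_abs]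
          have := abs_pos.2 hT
          field_simp
  · have h := hvac.sub_const (ω A • Ω)
    rw [sub_self] at h
    refine h.congr fun T => ?_
    rw [hsub]
    simp only [sub_apply, smul_apply, one_apply_eq_self]
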